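/- An infinite word is aperiodic if it is not eventually periodic. A word $v\in\{0,1\}^{\mathbb N}$ is sturmian if it is aperiodic and codes an exchange of two intervals: for some $\varepsilon\in(0,1)$ and $c\in\mathbb R$ there are disjoint intervals $J_0,J_1$ with endpoints $c,\,c+\varepsilon$ and $c+\varepsilon,\,c+1$ respectively, whose union $J$ is an interval, such that $R(x)=x+1-\varepsilon$ for $x\in J_0$, $R(x)=x-\varepsilon$ for $x\in J_1$ defines a bijection of $J$ onto itself, and $R^n(0)\in J_{v_n}$ for all $n\ge 0$. A word $u\in\{A,B,C\}^{\mathbb N}$ is a 3iet word if it codes an exchange of three intervals with permutation $(321)$: for some $\varepsilon\in(0,1)$, $\max(\varepsilon,1-\varepsilon)<l<1$ and $c\in\mathbb R$, with $\alpha=\varepsilon+l-1$, $\beta=1-l$, $\gamma=l-\varepsilon$ (so $\alpha,\beta,\gamma>0$ and $\alpha+2\beta+\gamma=1$), there are disjoint intervals $I_A,I_B,I_C$ with endpoints $c,\,c+\alpha$; $c+\alpha,\,c+\alpha+\beta$; $c+\alpha+\beta,\,c+\alpha+\beta+\gamma$ respectively, whose union $I$ is an interval, such that $T(x)=x+\beta+\gamma$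 on $I_A$, $T(x)=x+\gamma-\alpha$ on $I_B$, $T(x)=x-\alpha-\beta$ on $I_C$ defines a bijection of $I$ onto itself, and $T^n(0)\in I_{u_n}$ for all $n\ge 0$. (In both definitions an interval may or may not contain each of its endpoints.) Theorem A. Let $u\in\{A,B,C\}^{\mathbb N}$ be an infinite word such that for each letter $X$ the density $\lim_{n\to\infty}\frac1n\#\{0\le i<n : u_i=X\}$ exists and is positive. Let $\sigma,\sigma'$ be the morphisms given by $\sigma(A)=0$, $\sigma(B)=01$, $\sigma(C)=1$ and $\sigma'(A)=0$, $\sigma'(B)=10$, $\sigma'(C)=1$. Then $u$ is an aperiodic 3iet word if and only if both $\sigma(u)$ and $\sigma'(u)$ are sturmian words. The same equivalence holds if, in both definitions, all the intervals are required to be closed on the left and open on the right. -/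

import Mathlib

open Filter Topology

/-- The alphabet `{A, B, C}`. -/
inductive ABC : Type
  | A
  | B
  | C
  deriving DecidableEq

instance : Fintype ABC := ⟨{ABC.A, ABC.B, ABC.C}, fun a => by cases a <;> simp⟩

/-- The letter `a` has density `ρ` in the infinite word `u`. -/
def HasLetterDensity {α : Type} [DecidableEq α] (u : ℕ → α) (a : α) (ρ : ℝ) : Prop :=
  Tendsto (fun n : ℕ => (((Finset.range n).filter (fun i => u i = a)).card : ℝ) / (n : ℝ))
    atTop (𝓝 ρ)

/-- An infinite word is aperiodic if it is not eventually periodic. -/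
def IsAperiodicWord {α : Type} (u : ℕ → α) : Prop :=
  ¬ ∃ p : ℕ, 0 < p ∧ ∃ N : ℕ, ∀ n : ℕ, N ≤ n → u (n + p) = u n

/-! ### Images of infinite words under non-erasing morphisms -/

/-- The finite word `φ(u₀ u₁ ⋯ u_{n-1}) = φ(u₀) φ(u₁) ⋯ φ(u_{n-1})`, where the morphism `φ` is
given by the images of the letters. -/
def prefixImage {α β : Type} (φ : α → List β) (u : ℕ → α) (n : ℕ) : List β :=
  (List.range n).flatMap (fun i => φ (u i))

theorem le_length_prefixImage {α β : Type} (φ : α → List β) (hφ : ∀ a, φ a ≠ [])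
    (u : ℕ → α) (n : ℕ) : n ≤ (prefixImage φ u n).length := by
  induction n with
  | zero => simp
  | succ k ih =>
    have h : 0 < (φ (u k)).length := List.length_pos_iff.mpr (hφ (u k))
    simp only [prefixImage, List.range_succ, List.flatMap_append, List.length_append,
      List.flatMap_singleton] at ih ⊢
    omega

/-- The infinite word `φ(u) = φ(u₀) φ(u₁) φ(u₂) ⋯`, for a non-erasing morphism `φ`: its letter of
index `n` is the letter of index `n` of its prefix `φ(u₀ ⋯ u_n)`, which is long enough. -/
def imageWord {α β : Type} (φ : α → List β) (hφ : ∀ a, φ a ≠ []) (u : ℕ → α) : ℕ → β :=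
  fun n => (prefixImage φ u (n + 1))[n]'(le_length_prefixImage φ hφ u (n + 1))

/-- `σ : A ↦ 0, B ↦ 01, C ↦ 1`. -/
def sigmaMor : ABC → List (Fin 2)
  | ABC.A => [0]
  | ABC.B => [0, 1]
  | ABC.C => [1]

/-- `σ' : A ↦ 0, B ↦ 10, C ↦ 1`. -/
def sigmaMor' : ABC → List (Fin 2)
  | ABC.A => [0]
  | ABC.B => [1, 0]
  | ABC.C => [1]

theorem sigmaMor_ne_nil (a : ABC) : sigmaMor a ≠ [] := by cases a <;> simp [sigmaMor]

theorem sigmaMor'_ne_nil (a : ABC) : sigmaMor' a ≠ [] := by cases a <;> simp [sigmaMor']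

/-! ### Exchanges of intervals -/

/-- The piecewise translation `x ↦ x + t a` for `x ∈ I a` (the sets `I a` being disjoint). -/
noncomputable def exchangeMap {ι : Type} [Fintype ι] (I : ι → Set ℝ) (t : ι → ℝ) (x : ℝ) : ℝ :=
  x + ∑ a, Set.indicator (I a) (fun _ => t a) x

/-- The sets `I a` are disjoint intervals (with or without their endpoints) with endpoints
`lo a, hi a`, their union is an interval, and the translations `t a` exchange them, that is, they
define a bijection of the union onto itself. -/
structure IsIntervalExchange {ι : Type} [Fintype ι] (lo hi t : ι → ℝ) (I : ι → Set ℝ) : Prop where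
  Ioo_subset : ∀ a, Set.Ioo (lo a) (hi a) ⊆ I a
  subset_Icc : ∀ a, I a ⊆ Set.Icc (lo a) (hi a)
  disjoint : Pairwise (fun a b => Disjoint (I a) (I b))
  ordConnected : (⋃ a, I a).OrdConnected
  bijOn : Set.BijOn (exchangeMap I t) (⋃ a, I a) (⋃ a, I a)

/-- The word `u` codes the orbit of `0` under the exchange map of the family `I`. -/
def CodesOrbit {ι : Type} [Fintype ι] (I : ι → Set ℝ) (t : ι → ℝ) (u : ℕ → ι) : Prop :=
  ∀ n : ℕ, (exchangeMap I t)^[n] 0 ∈ I (u n)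

/-! #### Two intervals

Intervals of lengths `ε` and `1 - ε`, with left endpoint `c`; their exchange is the rotation of
angle `1 - ε` on an interval of length `1`. -/

/-- Left endpoints of the two intervals. -/
def lo2 (ε c : ℝ) : Fin 2 → ℝ := ![c, c + ε]

/-- Right endpoints of the two intervals. -/
def hi2 (ε c : ℝ) : Fin 2 → ℝ := ![c + ε, c + 1]

/-- Translations of the two intervals. -/
def tr2 (ε : ℝ) : Fin 2 → ℝ := ![1 - ε, -ε]

/-- Sturmian words: aperiodic words that code an exchange of two intervals. -/
def IsSturmian (v : ℕ → Fin 2) : Prop :=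
  IsAperiodicWord v ∧ ∃ ε c : ℝ, 0 < ε ∧ ε < 1 ∧
    ∃ J : Fin 2 → Set ℝ, IsIntervalExchange (lo2 ε c) (hi2 ε c) (tr2 ε) J ∧
      CodesOrbit J (tr2 ε) v

/-- Aperiodic words that code an exchange of two left-closed right-open intervals. -/
def IsLeftClosedSturmian (v : ℕ → Fin 2) : Prop :=
  IsAperiodicWord v ∧ ∃ ε c : ℝ, 0 < ε ∧ ε < 1 ∧
    CodesOrbit (fun a => Set.Ico (lo2 ε c a) (hi2 ε c a)) (tr2 ε) v

/-! #### Three intervals, permutation (321)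

With `α = ε + l - 1`, `β = 1 - l`, `γ = l - ε` (so that `α + 2β + γ = 1`, `ε = α + β` and
`l = α + β + γ`), the three intervals have lengths `α, β, γ` and left endpoint `c`; they are
translated by `β + γ`, `γ - α`, `-α - β` respectively. -/

/-- Left endpoints of the three intervals. -/
def lo3 (ε l c : ℝ) : ABC → ℝ
  | ABC.A => c
  | ABC.B => c + (ε + l - 1)
  | ABC.C => c + ε

/-- Right endpoints of the three intervals. -/
def hi3 (ε l c : ℝ) : ABC → ℝ
  | ABC.A => c + (ε + l - 1)
  | ABC.B => c + ε
  | ABC.C => c + l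

/-- Translations of the three intervals. -/
def tr3 (ε : ℝ) : ABC → ℝ
  | ABC.A => 1 - ε
  | ABC.B => 1 - 2 * ε
  | ABC.C => -ε

/-- 3iet words: words that code an exchange of three intervals of positive lengths with the
permutation (321). -/
def Is3iet (u : ℕ → ABC) : Prop :=
  ∃ ε l c : ℝ, 0 < ε ∧ ε < 1 ∧ max ε (1 - ε) < l ∧ l < 1 ∧
    ∃ I : ABC → Set ℝ, IsIntervalExchange (lo3 ε l c) (hi3 ε l c) (tr3 ε) I ∧
      CodesOrbit I (tr3 ε) u

/-- 3iet words for an exchange of three left-closed right-open intervals. -/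
def IsLeftClosed3iet (u : ℕ → ABC) : Prop :=
  ∃ ε l c : ℝ, 0 < ε ∧ ε < 1 ∧ max ε (1 - ε) < l ∧ l < 1 ∧ -l < c ∧ c ≤ 0 ∧
    CodesOrbit (fun a => Set.Ico (lo3 ε l c a) (hi3 ε l c a)) (tr3 ε) u

/-! The key identity is that the translation of each letter `a` under the three-interval exchange
`T` is the total translation of the word `σ(a)`, and also of `σ'(a)`, under the two-interval
exchange `R` with the same `ε`. For `B` this holds because `01` and `10` both move a point by `1 -
2ε`. So the orbit coded by `u` is the orbit coded by `σ(u)`, or by `σ'(u)`, observed at the starts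
of blocks, and `T` is `R` with the intermediate point of each visit to `I_B` skipped.

From three intervals to two, the skipped points are put back: adjoining `I_B + (1 - ε)` on the right
of `I` gives an exchange for `σ`, adjoining `I_B - ε` on the left gives one for `σ'`
(`exists_sigma`, `exists_sigma'`).

From two to three, let `c` and `c'` be the left endpoints of the exchanges coding `σ(u)` and
`σ'(u)`. Both orbits of `u` are bounded, which forces the two parameters `ε` to agree
(`eq_of_orbitPos_tr3_bounded`). The overlap of the two unit intervals, cut at `c' + ε` and `c + ε`,
is then a three-interval exchange with `l = 1 + c' - c` (`IsIntervalExchange.commonPartition`). Its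
three lengths are positive because every letter occurs infinitely often, by positive density, while
the orbit never repeats (`lengths_of_codings`).

Aperiodicity transfers because for each of the three words it is equivalent to the irrationality of
the common `ε`. -/

/-! ### Orbits as partial sums of translations -/

/-- The sum of the translations of the first `n` letters of `u`. -/
noncomputable def orbitPos {ι : Type} (t : ι → ℝ) (u : ℕ → ι) (n : ℕ) : ℝ :=
  ∑ i ∈ Finset.range n, t (u i)

theorem orbitPos_zero {ι : Type} (t : ι → ℝ) (u : ℕ → ι) : orbitPos t u 0 = 0 := by
  simp [orbitPos]

theorem orbitPos_succ {ι : Type} (t : ι → ℝ) (u : ℕ → ι) (n : ℕ) :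
    orbitPos t u (n + 1) = orbitPos t u n + t (u n) := by
  simp [orbitPos, Finset.sum_range_succ]

theorem exchangeMap_of_mem {ι : Type} [Fintype ι] {I : ι → Set ℝ} (t : ι → ℝ)
    (hI : Pairwise (fun a b => Disjoint (I a) (I b))) {a : ι} {x : ℝ} (hx : x ∈ I a) :
    exchangeMap I t x = x + t a := by
  classical
  unfold exchangeMap
  rw [Finset.sum_eq_single a]
  · rw [Set.indicator_of_mem hx]
  · intro b _ hb
    exact Set.indicator_of_notMem (fun h => Set.disjoint_left.1 (hI hb) h hx) _
  · simp

/-- Removes the dynamics: as long as the letters are right, the iterates are partial sums of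
translations, so a coding becomes a pointwise membership condition. -/
theorem codesOrbit_iff {ι : Type} [Fintype ι] {I : ι → Set ℝ} {t : ι → ℝ}
    (hI : Pairwise (fun a b => Disjoint (I a) (I b))) {u : ℕ → ι} :
    CodesOrbit I t u ↔ ∀ n, orbitPos t u n ∈ I (u n) := by
  constructor
  · intro h
    have key : ∀ n, (exchangeMap I t)^[n] 0 = orbitPos t u n := by
      intro n
      induction n with
      | zero => simp [orbitPos_zero]
      | succ n ih =>
        rw [Function.iterate_succ_apply', exchangeMap_of_mem t hI (h n), ih, orbitPos_succ]
    intro n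
    rw [← key n]
    exact h n
  · intro h
    have key : ∀ n, (exchangeMap I t)^[n] 0 = orbitPos t u n := by
      intro n
      induction n with
      | zero => simp [orbitPos_zero]
      | succ n ih =>
        rw [Function.iterate_succ_apply', ih, exchangeMap_of_mem t hI (h n), orbitPos_succ]
    intro n
    rw [key n]
    exact h n

theorem bijOn_exchangeMap_iff {ι : Type} [Fintype ι] {I : ι → Set ℝ} {t : ι → ℝ}
    (hI : Pairwise (fun a b => Disjoint (I a) (I b))) :
    Set.BijOn (exchangeMap I t) (⋃ a, I a) (⋃ a, I a) ↔
      (∀ a x, x ∈ I a → ∃ b, x + t a ∈ I b) ∧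
      (∀ a b x y, x ∈ I a → y ∈ I b → x + t a = y + t b → x = y) ∧
      (∀ b y, y ∈ I b → ∃ a, y - t a ∈ I a) := by
  constructor
  · rintro ⟨h1, h2, h3⟩
    refine ⟨?_, ?_, ?_⟩
    · intro a x hx
      have := h1 (Set.mem_iUnion.2 ⟨a, hx⟩)
      rw [exchangeMap_of_mem t hI hx] at this
      exact Set.mem_iUnion.1 this
    · intro a b x y hx hy hxy
      apply h2 (Set.mem_iUnion.2 ⟨a, hx⟩) (Set.mem_iUnion.2 ⟨b, hy⟩)
      rw [exchangeMap_of_mem t hI hx, exchangeMap_of_mem t hI hy, hxy]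
    · intro b y hy
      obtain ⟨x, hx, hxy⟩ := h3 (Set.mem_iUnion.2 ⟨b, hy⟩)
      obtain ⟨a, ha⟩ := Set.mem_iUnion.1 hx
      rw [exchangeMap_of_mem t hI ha] at hxy
      refine ⟨a, ?_⟩
      rwa [← hxy, add_sub_cancel_right]
  · rintro ⟨h1, h2, h3⟩
    refine ⟨?_, ?_, ?_⟩
    · intro x hx
      obtain ⟨a, ha⟩ := Set.mem_iUnion.1 hx
      rw [exchangeMap_of_mem t hI ha]
      exact Set.mem_iUnion.2 (h1 a x ha)
    · intro x hx y hy hxy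
      obtain ⟨a, ha⟩ := Set.mem_iUnion.1 hx
      obtain ⟨b, hb⟩ := Set.mem_iUnion.1 hy
      rw [exchangeMap_of_mem t hI ha, exchangeMap_of_mem t hI hb] at hxy
      exact h2 a b x y ha hb hxy
    · intro y hy
      obtain ⟨b, hb⟩ := Set.mem_iUnion.1 hy
      obtain ⟨a, ha⟩ := h3 b y hb
      refine ⟨y - t a, Set.mem_iUnion.2 ⟨a, ha⟩, ?_⟩
      rw [exchangeMap_of_mem t hI ha, sub_add_cancel]

theorem ordConnected_of_Ioo_subset {S : Set ℝ} {a b : ℝ} (h1 : Set.Ioo a b ⊆ S)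
    (h2 : S ⊆ Set.Icc a b) : S.OrdConnected := by
  refine ⟨fun x hx y hy z hz => ?_⟩
  rcases hz.1.eq_or_lt with h | h
  · rwa [← h]
  rcases hz.2.eq_or_lt with h' | h'
  · rwa [h']
  exact h1 ⟨(h2 hx).1.trans_lt h, h'.trans_le (h2 hy).2⟩

/-! ### Aperiodicity and irrationality -/

theorem orbitPos_eq_sub {ι : Type} {t : ι → ℝ} {P Q : ι → ℤ} {ε : ℝ}
    (ht : ∀ a, t a = P a - Q a * ε) (u : ℕ → ι) (n : ℕ) :
    orbitPos t u n = (∑ i ∈ Finset.range n, P (u i) : ℤ) - (∑ i ∈ Finset.range n, Q (u i) : ℤ) * ε := by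
  simp only [orbitPos, ht]
  push_cast
  rw [Finset.sum_sub_distrib, Finset.sum_mul]

/-- The coefficient of `ε` in the position strictly increases with time, so a repeated position
would make a nonzero integer multiple of `ε` an integer. -/
theorem orbitPos_injective {ι : Type} {t : ι → ℝ} {P Q : ι → ℤ} {ε : ℝ}
    (ht : ∀ a, t a = P a - Q a * ε) (hQ : ∀ a, 0 < Q a) (hε : Irrational ε) (u : ℕ → ι) :
    Function.Injective (orbitPos t u) := by
  have hmono : StrictMono (fun n => ∑ i ∈ Finset.range n, Q (u i)) := by
    apply strictMono_nat_of_lt_succ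
    intro n
    rw [Finset.sum_range_succ]
    linarith [hQ (u n)]
  intro m n hmn
  apply hmono.injective
  by_contra hne
  rw [orbitPos_eq_sub ht, orbitPos_eq_sub ht] at hmn
  have hne' : (∑ i ∈ Finset.range m, Q (u i)) - (∑ i ∈ Finset.range n, Q (u i)) ≠ 0 :=
    sub_ne_zero.2 hne
  apply (hε.intCast_mul hne').ne_int
    ((∑ i ∈ Finset.range m, P (u i)) - (∑ i ∈ Finset.range n, P (u i)))
  push_cast at hmn ⊢
  linarith

theorem eq_zero_of_nat_mul_bounded {D M : ℝ} (h : ∀ k : ℕ, |(k : ℝ) * D| ≤ M) : D = 0 := by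
  by_contra hD
  obtain ⟨k, hk⟩ := exists_nat_gt (M / |D|)
  have := h k
  rw [abs_mul, Nat.abs_cast] at this
  rw [div_lt_iff₀ (abs_pos.2 hD)] at hk
  linarith

/-- Over each period the position changes by a fixed amount `D`. Boundedness forces `D = 0`, which
contradicts injectivity of the orbit. -/
theorem isAperiodicWord_of_irrational {ι : Type} {t : ι → ℝ} {P Q : ι → ℤ} {ε M : ℝ}
    (ht : ∀ a, t a = P a - Q a * ε) (hQ : ∀ a, 0 < Q a) (hε : Irrational ε) {u : ℕ → ι}
    (hM : ∀ n, |orbitPos t u n| ≤ M) : IsAperiodicWord u := by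
  rintro ⟨p, hp, N, hN⟩
  set D := orbitPos t u (N + p) - orbitPos t u N with hD
  have hstep : ∀ k, orbitPos t u (N + k + p) - orbitPos t u (N + k) = D := by
    intro k
    induction k with
    | zero => rfl
    | succ k ih =>
      rw [show N + (k + 1) + p = N + k + p + 1 by ring, ← add_assoc N k 1, orbitPos_succ,
        orbitPos_succ, hN (N + k) (by omega), ← ih]
      ring
  have hmul : ∀ k : ℕ, orbitPos t u (N + k * p) = orbitPos t u N + k * D := by
    intro k
    induction k with
    | zero => simp
    | succ k ih =>
      have := hstep (k * p)
      rw [show N + (k + 1) * p = N + k * p + p by ring]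
      push_cast
      linarith
  have h0 : D = 0 := by
    apply eq_zero_of_nat_mul_bounded (M := M + M)
    intro k
    have h1 := abs_le.1 (hM (N + k * p))
    have h2 := abs_le.1 (hM N)
    rw [hmul] at h1
    rw [abs_le]
    constructor <;> linarith
  have := orbitPos_injective ht hQ hε u (sub_eq_zero.1 (hD ▸ h0))
  omega

/-- For rational `ε` the bounded orbit lies in a lattice, hence is finite, and some position recurs.
By disjointness a position determines its letter and so the whole future of the word. -/
theorem irrational_of_isAperiodicWord {ι : Type} {t : ι → ℝ} {P Q : ι → ℤ} {ε M : ℝ}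
    (ht : ∀ a, t a = P a - Q a * ε) {I : ι → Set ℝ}
    (hI : Pairwise (fun a b => Disjoint (I a) (I b))) {u : ℕ → ι}
    (hu : ∀ n, orbitPos t u n ∈ I (u n)) (hM : ∀ n, |orbitPos t u n| ≤ M)
    (hap : IsAperiodicWord u) : Irrational ε := by
  rintro ⟨q, rfl⟩
  apply hap
  have hq : (q : ℝ) * q.den = q.num := by exact_mod_cast Rat.mul_den_eq_num q
  have hpos : (0 : ℝ) < q.den := by exact_mod_cast q.den_pos
  have hint : ∀ n, ∃ z : ℤ, orbitPos t u n * q.den = z := by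
    intro n
    refine ⟨(∑ i ∈ Finset.range n, P (u i)) * q.den - (∑ i ∈ Finset.range n, Q (u i)) * q.num, ?_⟩
    rw [orbitPos_eq_sub ht]
    push_cast
    rw [← hq]
    ring
  choose z hz using hint
  obtain ⟨K, hK⟩ := exists_nat_gt (M * q.den)
  have hmem : ∀ n, z n ∈ Set.Icc (-(K : ℤ)) K := by
    intro n
    have h1 : |(z n : ℝ)| ≤ K := by
      rw [← hz, abs_mul, abs_of_pos hpos]
      exact (mul_le_mul_of_nonneg_right (hM n) hpos.le).trans hK.le
    rw [Set.mem_Icc, ← abs_le]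
    exact_mod_cast h1
  obtain ⟨i, -, j, -, hij, heq⟩ := Set.infinite_univ.exists_ne_map_eq_of_mapsTo
    (f := z) (s := Set.univ) (fun n _ => hmem n) (Set.finite_Icc _ _)
  wlog hlt : i < j generalizing i j
  · exact this j i hij.symm heq.symm (lt_of_le_of_ne (not_lt.1 hlt) hij.symm)
  have hpo : orbitPos t u j = orbitPos t u i := by
    apply mul_right_cancel₀ hpos.ne'
    rw [hz, hz, heq]
  have hlet : ∀ m n, orbitPos t u m = orbitPos t u n → u m = u n := by
    intro m n h
    by_contra hne
    exact Set.disjoint_left.1 (hI hne) (hu m) (h ▸ hu n)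
  have hk : ∀ k, orbitPos t u (j + k) = orbitPos t u (i + k) := by
    intro k
    induction k with
    | zero => exact hpo
    | succ k ih =>
      rw [← add_assoc, ← add_assoc, orbitPos_succ, orbitPos_succ, ih, hlet _ _ ih]
  refine ⟨j - i, by omega, i, fun n hn => ?_⟩
  obtain ⟨k, rfl⟩ := Nat.exists_eq_add_of_le hn
  rw [show i + k + (j - i) = j + k by omega]
  exact hlet _ _ (hk k)

/-! ### Images under morphisms -/

theorem prefixImage_succ {α β : Type} (φ : α → List β) (u : ℕ → α) (n : ℕ) :
    prefixImage φ u (n + 1) = prefixImage φ u n ++ φ (u n) := by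
  simp [prefixImage, List.range_succ]

theorem prefixImage_prefix {α β : Type} (φ : α → List β) (u : ℕ → α) {m n : ℕ} (h : m ≤ n) :
    prefixImage φ u m <+: prefixImage φ u n := by
  induction n, h using Nat.le_induction with
  | base => exact List.prefix_refl _
  | succ n _ ih =>
    rw [prefixImage_succ]
    exact ih.trans (List.prefix_append _ _)

theorem imageWord_eq_getElem {α β : Type} (φ : α → List β) (hφ : ∀ a, φ a ≠ []) (u : ℕ → α)
    (n m : ℕ) (hm : m < (prefixImage φ u n).length) :
    imageWord φ hφ u m = (prefixImage φ u n)[m] := by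
  unfold imageWord
  rcases le_total (m + 1) n with h | h
  · exact (prefixImage_prefix φ u h).getElem _
  · exact ((prefixImage_prefix φ u h).getElem _).symm

theorem imageWord_add {α β : Type} (φ : α → List β) (hφ : ∀ a, φ a ≠ []) (u : ℕ → α)
    (n j : ℕ) (hj : j < (φ (u n)).length) :
    imageWord φ hφ u ((prefixImage φ u n).length + j) = (φ (u n))[j] := by
  have h := imageWord_eq_getElem φ hφ u (n + 1) ((prefixImage φ u n).length + j)
    (by rw [prefixImage_succ, List.length_append]; omega)
  rw [h]
  simp [prefixImage_succ]

theorem exists_eq_length_prefixImage_add {α β : Type} (φ : α → List β) (hφ : ∀ a, φ a ≠ [])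
    (u : ℕ → α) (m : ℕ) :
    ∃ n j, j < (φ (u n)).length ∧ m = (prefixImage φ u n).length + j := by
  induction m with
  | zero => exact ⟨0, 0, List.length_pos_iff.2 (hφ _), by simp [prefixImage]⟩
  | succ m ih =>
    obtain ⟨n, j, hj, rfl⟩ := ih
    by_cases h : j + 1 < (φ (u n)).length
    · exact ⟨n, j + 1, h, by ring⟩
    · refine ⟨n + 1, 0, List.length_pos_iff.2 (hφ _), ?_⟩
      rw [prefixImage_succ, List.length_append]
      omega

/-- Since `s a` is the displacement along the block `φ a`, the two orbits meet at the start of each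
block; inside a block only the letters already read contribute. -/
theorem orbitPos_imageWord_add {α β : Type} (φ : α → List β) (hφ : ∀ a, φ a ≠ []) (u : ℕ → α)
    {s : α → ℝ} {t : β → ℝ} (hs : ∀ a, s a = ((φ a).map t).sum) (n j : ℕ)
    (hj : j ≤ (φ (u n)).length) :
    orbitPos t (imageWord φ hφ u) ((prefixImage φ u n).length + j) =
      orbitPos s u n + (((φ (u n)).map t).take j).sum := by
  have key : ∀ n j, j ≤ (φ (u n)).length →
      orbitPos t (imageWord φ hφ u) ((prefixImage φ u n).length + j) =
        orbitPos t (imageWord φ hφ u) (prefixImage φ u n).length +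
          (((φ (u n)).map t).take j).sum := by
    intro n j
    induction j with
    | zero => simp
    | succ j ih =>
      intro hj
      rw [← add_assoc, orbitPos_succ, ih (by omega), imageWord_add φ hφ u n j (by omega),
        List.sum_take_succ _ _ (by simpa using hj), List.getElem_map, add_assoc]
  rw [key n j hj]
  congr 1
  clear hj
  induction n with
  | zero => simp [prefixImage, orbitPos]
  | succ n ih =>
    rw [prefixImage_succ, List.length_append, key n _ le_rfl, ih, orbitPos_succ, hs,
      List.take_of_length_le (by simp)]

theorem forall_orbitPos_imageWord_mem_iff {α β : Type} (φ : α → List β) (hφ : ∀ a, φ a ≠ [])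
    (u : ℕ → α) {s : α → ℝ} {t : β → ℝ} (hs : ∀ a, s a = ((φ a).map t).sum) (J : β → Set ℝ) :
    (∀ m, orbitPos t (imageWord φ hφ u) m ∈ J (imageWord φ hφ u m)) ↔
      ∀ n j, ∀ hj : j < (φ (u n)).length,
        orbitPos s u n + (((φ (u n)).map t).take j).sum ∈ J ((φ (u n))[j]) := by
  constructor
  · intro h n j hj
    rw [← orbitPos_imageWord_add φ hφ u hs n j hj.le, ← imageWord_add φ hφ u n j hj]
    exact h _
  · intro h m
    obtain ⟨n, j, hj, rfl⟩ := exists_eq_length_prefixImage_add φ hφ u m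
    rw [orbitPos_imageWord_add φ hφ u hs n j hj.le, imageWord_add φ hφ u n j hj]
    exact h n j hj

/-! ### Densities -/

/-- A letter with finitely many occurrences has bounded counts, hence density zero. -/
theorem HasLetterDensity.infinite {α : Type} [DecidableEq α] {u : ℕ → α} {a : α} {ρ : ℝ}
    (h : HasLetterDensity u a ρ) (hρ : 0 < ρ) : {n | u n = a}.Infinite := by
  intro hfin
  have h0 : Tendsto (fun n : ℕ => (((Finset.range n).filter (fun i => u i = a)).card : ℝ) / (n : ℝ))
      atTop (𝓝 0) := by
    refine squeeze_zero (fun n => by positivity) (fun n => ?_)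
      (tendsto_const_div_atTop_nhds_zero_nat (hfin.toFinset.card : ℝ))
    gcongr
    intro i
    simp
  exact hρ.ne' (tendsto_nhds_unique h h0)

/-! ### The codings by `σ` and `σ'` -/

/-- The points of which the orbit under the exchange of `J 0, J 1` starts with `σ(a)`. -/
def sigmaCylinder (ε : ℝ) (J : Fin 2 → Set ℝ) : ABC → Set ℝ
  | ABC.A => J 0
  | ABC.B => {x | x ∈ J 0 ∧ x + (1 - ε) ∈ J 1}
  | ABC.C => J 1

/-- The points of which the orbit under the exchange of `J 0, J 1` starts with `σ'(a)`. -/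
def sigmaCylinder' (ε : ℝ) (J : Fin 2 → Set ℝ) : ABC → Set ℝ
  | ABC.A => J 0
  | ABC.B => {x | x ∈ J 1 ∧ x - ε ∈ J 0}
  | ABC.C => J 1

theorem tr3_eq_sum_sigmaMor (ε : ℝ) (a : ABC) : tr3 ε a = ((sigmaMor a).map (tr2 ε)).sum := by
  cases a <;> simp [tr3, tr2, sigmaMor]; ring

theorem tr3_eq_sum_sigmaMor' (ε : ℝ) (a : ABC) : tr3 ε a = ((sigmaMor' a).map (tr2 ε)).sum := by
  cases a <;> simp [tr3, tr2, sigmaMor']; ring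

theorem codesOrbit_sigma_iff {ε : ℝ} {J : Fin 2 → Set ℝ}
    (hJ : Pairwise (fun a b => Disjoint (J a) (J b))) (u : ℕ → ABC) :
    CodesOrbit J (tr2 ε) (imageWord sigmaMor sigmaMor_ne_nil u) ↔
      ∀ n, orbitPos (tr3 ε) u n ∈ sigmaCylinder ε J (u n) := by
  rw [codesOrbit_iff hJ, forall_orbitPos_imageWord_mem_iff _ _ _ (tr3_eq_sum_sigmaMor ε)]
  refine forall_congr' fun n => ?_
  generalize orbitPos (tr3 ε) u n = x
  generalize u n = a
  constructor
  · intro h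
    cases a with
    | A => simpa [sigmaMor, sigmaCylinder] using h 0 (by simp [sigmaMor])
    | B => exact ⟨by simpa [sigmaMor] using h 0 (by simp [sigmaMor]),
        by simpa [sigmaMor, tr2] using h 1 (by simp [sigmaMor])⟩
    | C => simpa [sigmaMor, sigmaCylinder] using h 0 (by simp [sigmaMor])
  · intro h j hj
    cases a with
    | A =>
      obtain rfl : j = 0 := by simpa [sigmaMor] using hj
      simpa [sigmaMor, sigmaCylinder] using h
    | B =>
      have hj' : j < 2 := hj
      interval_cases j
      · simpa [sigmaMor] using h.1
      · simpa [sigmaMor, tr2] using h.2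
    | C =>
      obtain rfl : j = 0 := by simpa [sigmaMor] using hj
      simpa [sigmaMor, sigmaCylinder] using h

theorem codesOrbit_sigma'_iff {ε : ℝ} {J : Fin 2 → Set ℝ}
    (hJ : Pairwise (fun a b => Disjoint (J a) (J b))) (u : ℕ → ABC) :
    CodesOrbit J (tr2 ε) (imageWord sigmaMor' sigmaMor'_ne_nil u) ↔
      ∀ n, orbitPos (tr3 ε) u n ∈ sigmaCylinder' ε J (u n) := by
  rw [codesOrbit_iff hJ, forall_orbitPos_imageWord_mem_iff _ _ _ (tr3_eq_sum_sigmaMor' ε)]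
  refine forall_congr' fun n => ?_
  generalize orbitPos (tr3 ε) u n = x
  generalize u n = a
  constructor
  · intro h
    cases a with
    | A => simpa [sigmaMor', sigmaCylinder'] using h 0 (by simp [sigmaMor'])
    | B => exact ⟨by simpa [sigmaMor'] using h 0 (by simp [sigmaMor']),
        by simpa [sigmaMor', tr2, sub_eq_add_neg] using h 1 (by simp [sigmaMor'])⟩
    | C => simpa [sigmaMor', sigmaCylinder'] using h 0 (by simp [sigmaMor'])
  · intro h j hj
    cases a with
    | A =>
      obtain rfl : j = 0 := by simpa [sigmaMor'] using hj
      simpa [sigmaMor', sigmaCylinder'] using h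
    | B =>
      have hj' : j < 2 := hj
      interval_cases j
      · simpa [sigmaMor'] using h.1
      · simpa [sigmaMor', tr2, sub_eq_add_neg] using h.2
    | C =>
      obtain rfl : j = 0 := by simpa [sigmaMor'] using hj
      simpa [sigmaMor', sigmaCylinder'] using h

/-! ### From three intervals to two -/

theorem pairwise_disjoint_fin_two {J : Fin 2 → Set ℝ} (h : Disjoint (J 0) (J 1)) :
    Pairwise (fun a b => Disjoint (J a) (J b)) := by
  intro a b hab
  fin_cases a <;> fin_cases b
  · exact absurd rfl hab
  · exact h
  · exact h.symm
  · exact absurd rfl hab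

theorem pairwise_disjoint_ABC {I : ABC → Set ℝ} (h1 : Disjoint (I .A) (I .B))
    (h2 : Disjoint (I .A) (I .C)) (h3 : Disjoint (I .B) (I .C)) :
    Pairwise (fun a b => Disjoint (I a) (I b)) := by
  intro a b hab
  cases a <;> cases b <;> first | exact absurd rfl hab | assumption | (apply Disjoint.symm; assumption)

/-- Turns the definition into conditions open to linear arithmetic, whichever endpoints belong to
the intervals. Injectivity can fail only if `x` and `x + 1` both occur, that is, at the two extreme
endpoints. -/
theorem isIntervalExchange_fin_two_iff {ε c : ℝ} (hε : 0 < ε) (hε' : ε < 1) {J : Fin 2 → Set ℝ} :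
    IsIntervalExchange (lo2 ε c) (hi2 ε c) (tr2 ε) J ↔
      Set.Ioo c (c + 1) ⊆ J 0 ∪ J 1 ∧ J 0 ⊆ Set.Icc c (c + ε) ∧ J 1 ⊆ Set.Icc (c + ε) (c + 1) ∧
      Disjoint (J 0) (J 1) ∧
      (∀ x ∈ J 0, x + (1 - ε) ∈ J 0 ∪ J 1) ∧ (∀ x ∈ J 1, x - ε ∈ J 0 ∪ J 1) ∧
      (∀ x ∈ J 0, x + 1 ∉ J 1) ∧
      (∀ y ∈ J 0 ∪ J 1, y - (1 - ε) ∈ J 0 ∨ y + ε ∈ J 1) := by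
  have hU : (⋃ a, J a) = J 0 ∪ J 1 := by
    ext x; simp [Fin.exists_fin_two]
  constructor
  · intro h
    obtain ⟨h1, h2, h3⟩ := (bijOn_exchangeMap_iff h.disjoint).1 h.bijOn
    simp only [Fin.forall_fin_two, Fin.exists_fin_two, tr2, Matrix.cons_val_zero,
      Matrix.cons_val_one, sub_neg_eq_add, ← sub_eq_add_neg] at h1 h2 h3
    have i0 : Set.Ioo c (c + ε) ⊆ J 0 := h.Ioo_subset 0
    have i1 : Set.Ioo (c + ε) (c + 1) ⊆ J 1 := h.Ioo_subset 1
    refine ⟨?_, h.subset_Icc 0, h.subset_Icc 1, h.disjoint (by simp), h1.1, h1.2, ?_, ?_⟩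
    · rw [← hU]
      intro x hx
      -- The midpoints of the two intervals; they enclose `c + ε`, which order-connectedness then
      -- places in the union.
      have hl : c + ε / 2 ∈ ⋃ a, J a := hU ▸ Or.inl (i0 ⟨by linarith, by linarith⟩)
      have hr : c + (1 + ε) / 2 ∈ ⋃ a, J a := hU ▸ Or.inr (i1 ⟨by linarith, by linarith⟩)
      rcases lt_trichotomy x (c + ε) with hlt | rfl | hlt
      · exact hU ▸ Or.inl (i0 ⟨hx.1, hlt⟩)
      · exact h.ordConnected.out hl hr ⟨by linarith, by linarith⟩
      · exact hU ▸ Or.inr (i1 ⟨hlt, hx.2⟩)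
    · intro x hx hx'
      have := h2.1.2 x (x + 1) hx hx' (by ring)
      linarith
    · rintro y (hy | hy)
      exacts [h3.1 y hy, h3.2 y hy]
  · rintro ⟨h1, h2, h3, h4, h5, h6, h7, h8⟩
    have hd := pairwise_disjoint_fin_two h4
    refine ⟨?_, ?_, hd, ?_, ?_⟩
    · rw [Fin.forall_fin_two]
      simp only [lo2, hi2, Matrix.cons_val_zero, Matrix.cons_val_one]
      constructor
      · intro x hx
        rcases h1 ⟨hx.1, by linarith [hx.2]⟩ with h | h
        · exact h
        · linarith [(h3 h).1, hx.2]
      · intro x hx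
        rcases h1 ⟨by linarith [hx.1], hx.2⟩ with h | h
        · linarith [(h2 h).2, hx.1]
        · exact h
    · rw [Fin.forall_fin_two]
      exact ⟨h2, h3⟩
    · rw [hU]
      refine ordConnected_of_Ioo_subset h1 ?_
      rintro x (hx | hx)
      · exact ⟨(h2 hx).1, by linarith [(h2 hx).2]⟩
      · exact ⟨by linarith [(h3 hx).1], (h3 hx).2⟩
    · rw [bijOn_exchangeMap_iff hd]
      simp only [Fin.forall_fin_two, Fin.exists_fin_two, tr2, Matrix.cons_val_zero,
        Matrix.cons_val_one, sub_neg_eq_add, ← sub_eq_add_neg]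
      refine ⟨⟨h5, h6⟩, ⟨⟨?_, ?_⟩, ?_, ?_⟩, fun y hy => h8 y (Or.inl hy),
        fun y hy => h8 y (Or.inr hy)⟩
      · intro x y _ _ h; linarith
      · intro x y hx hy h
        exact absurd (by rwa [show x + 1 = y by linarith]) (h7 x hx)
      · intro x y hx hy h
        exact absurd (by rwa [show y + 1 = x by linarith]) (h7 y hy)
      · intro x y _ _ h; linarith

/-- The three exclusions are the possible collisions of images of distinct intervals: equal images
under `A, C`, `A, B` and `B, C` lie at distances `1`, `ε` and `1 - ε` before the move. -/
theorem isIntervalExchange_ABC_iff {ε l c : ℝ} (hl : max ε (1 - ε) < l) (hl' : l < 1)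
    {I : ABC → Set ℝ} :
    IsIntervalExchange (lo3 ε l c) (hi3 ε l c) (tr3 ε) I ↔
      Set.Ioo c (c + l) ⊆ I .A ∪ I .B ∪ I .C ∧ I .A ⊆ Set.Icc c (c + (ε + l - 1)) ∧
      I .B ⊆ Set.Icc (c + (ε + l - 1)) (c + ε) ∧ I .C ⊆ Set.Icc (c + ε) (c + l) ∧
      Disjoint (I .A) (I .B) ∧ Disjoint (I .A) (I .C) ∧ Disjoint (I .B) (I .C) ∧
      (∀ x ∈ I .A, x + (1 - ε) ∈ I .A ∪ I .B ∪ I .C) ∧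
      (∀ x ∈ I .B, x + (1 - 2 * ε) ∈ I .A ∪ I .B ∪ I .C) ∧
      (∀ x ∈ I .C, x - ε ∈ I .A ∪ I .B ∪ I .C) ∧
      (∀ x ∈ I .A, x + 1 ∉ I .C) ∧ (∀ x ∈ I .A, x + ε ∉ I .B) ∧
      (∀ x ∈ I .B, x + (1 - ε) ∉ I .C) ∧
      (∀ y ∈ I .A ∪ I .B ∪ I .C, y - (1 - ε) ∈ I .A ∨ y - (1 - 2 * ε) ∈ I .B ∨ y + ε ∈ I .C) := by
  have hU : (⋃ a, I a) = I .A ∪ I .B ∪ I .C := by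
    ext x
    simp only [Set.mem_iUnion, Set.mem_union]
    constructor
    · rintro ⟨a, ha⟩
      cases a <;> simp [ha]
    · rintro ((h | h) | h)
      exacts [⟨_, h⟩, ⟨_, h⟩, ⟨_, h⟩]
  have hE : ∀ p : ABC → Prop, (∃ a, p a) ↔ p .A ∨ p .B ∨ p .C := by
    intro p
    constructor
    · rintro ⟨a, ha⟩
      cases a <;> simp [ha]
    · rintro (h | h | h)
      exacts [⟨_, h⟩, ⟨_, h⟩, ⟨_, h⟩]
  have hA : ∀ p : ABC → Prop, (∀ a, p a) ↔ p .A ∧ p .B ∧ p .C := by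
    intro p
    exact ⟨fun h => ⟨h _, h _, h _⟩, fun h a => by cases a; exacts [h.1, h.2.1, h.2.2]⟩
  obtain ⟨hl1, hl2⟩ := max_lt_iff.1 hl
  constructor
  · intro h
    obtain ⟨h1, h2, h3⟩ := (bijOn_exchangeMap_iff h.disjoint).1 h.bijOn
    simp only [hA, hE, tr3, sub_neg_eq_add, ← sub_eq_add_neg] at h1 h2 h3
    have iA : Set.Ioo c (c + (ε + l - 1)) ⊆ I .A := h.Ioo_subset .A
    have iC : Set.Ioo (c + ε) (c + l) ⊆ I .C := h.Ioo_subset .C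
    have hor : ∀ x, x ∈ I .A ∪ I .B ∪ I .C ↔ x ∈ I .A ∨ x ∈ I .B ∨ x ∈ I .C := by
      intro x; simp only [Set.mem_union, or_assoc]
    refine ⟨?_, h.subset_Icc .A, h.subset_Icc .B, h.subset_Icc .C, h.disjoint (by simp),
      h.disjoint (by simp), h.disjoint (by simp), fun x hx => (hor _).2 (h1.1 x hx),
      fun x hx => (hor _).2 (h1.2.1 x hx), fun x hx => (hor _).2 (h1.2.2 x hx), ?_, ?_, ?_, ?_⟩
    · rw [← hU]
      intro x hx
      rcases lt_or_ge x (c + (ε + l - 1)) with hlt | hge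
      · exact Set.mem_iUnion.2 ⟨_, iA ⟨hx.1, hlt⟩⟩
      rcases lt_or_ge (c + ε) x with hlt | hge'
      · exact Set.mem_iUnion.2 ⟨_, iC ⟨hlt, hx.2⟩⟩
      refine h.ordConnected.out
        (Set.mem_iUnion.2 ⟨_, iA (?_ : c + (ε + l - 1) / 2 ∈ _)⟩)
        (Set.mem_iUnion.2 ⟨_, iC (?_ : c + (ε + l) / 2 ∈ _)⟩) ⟨?_, ?_⟩
      · constructor <;> linarith
      · constructor <;> linarith
      · linarith
      · linarith
    · intro x hx hx'
      have := h2.1.2.2 x (x + 1) hx hx' (by ring)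
      linarith
    · intro x hx hx'
      have := h2.1.2.1 x (x + ε) hx hx' (by ring)
      linarith
    · intro x hx hx'
      have := h2.2.1.2.2 x (x + (1 - ε)) hx hx' (by ring)
      linarith
    · rintro y ((hy | hy) | hy)
      exacts [h3.1 y hy, h3.2.1 y hy, h3.2.2 y hy]
  · rintro ⟨h1, a1, b1, c1, dAB, dAC, dBC, a2, b2, c2, hAC, hAB, hBC, h8⟩
    have hd := pairwise_disjoint_ABC dAB dAC dBC
    refine ⟨?_, ?_, hd, ?_, ?_⟩
    · rw [hA]
      simp only [lo3, hi3]
      refine ⟨fun x hx => ?_, fun x hx => ?_, fun x hx => ?_⟩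
      · rcases h1 ⟨hx.1, by linarith [hx.2]⟩ with (h | h) | h
        · exact h
        · linarith [(b1 h).1, hx.2]
        · linarith [(c1 h).1, hx.2]
      · rcases h1 (⟨by linarith [hx.1], by linarith [hx.2]⟩ : x ∈ Set.Ioo c (c + l))
          with (h | h) | h
        · linarith [(a1 h).2, hx.1]
        · exact h
        · linarith [(c1 h).1, hx.2]
      · rcases h1 ⟨by linarith [hx.1], hx.2⟩ with (h | h) | h
        · linarith [(a1 h).2, hx.1]
        · linarith [(b1 h).2, hx.1]
        · exact h
    · rw [hA]
      exact ⟨a1, b1, c1⟩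
    · rw [hU]
      refine ordConnected_of_Ioo_subset h1 ?_
      rintro x ((hx | hx) | hx)
      · exact ⟨(a1 hx).1, by linarith [(a1 hx).2]⟩
      · exact ⟨by linarith [(b1 hx).1], by linarith [(b1 hx).2]⟩
      · exact ⟨by linarith [(c1 hx).1], (c1 hx).2⟩
    · rw [bijOn_exchangeMap_iff hd]
      simp only [hA, hE, tr3, sub_neg_eq_add, ← sub_eq_add_neg, ← or_assoc]
      simp only [← or_assoc] at h8
      refine ⟨⟨a2, b2, c2⟩, ⟨⟨?_, ?_, ?_⟩, ⟨?_, ?_, ?_⟩, ?_, ?_, ?_⟩,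
        fun y hy => h8 y (Or.inl (Or.inl hy)), fun y hy => h8 y (Or.inl (Or.inr hy)),
        fun y hy => h8 y (Or.inr hy)⟩
      · intro x y _ _ h; linarith
      · intro x y hx hy h
        exact absurd (by rwa [show x + ε = y by linarith]) (hAB x hx)
      · intro x y hx hy h
        exact absurd (by rwa [show x + 1 = y by linarith]) (hAC x hx)
      · intro x y hx hy h
        exact absurd (by rwa [show y + ε = x by linarith]) (hAB y hy)
      · intro x y _ _ h; linarith
      · intro x y hx hy h
        exact absurd (by rwa [show x + (1 - ε) = y by linarith]) (hBC x hx)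
      · intro x y hx hy h
        exact absurd (by rwa [show y + 1 = x by linarith]) (hAC y hy)
      · intro x y hx hy h
        exact absurd (by rwa [show y + (1 - ε) = x by linarith]) (hBC y hy)
      · intro x y _ _ h; linarith

/-- The point skipped by `T` at `x ∈ I_B` is `x + (1 - ε)`. These points fill the gap from `c + l`
to `c + 1`, so they are added to `I_C` to form `J 1`. -/
theorem IsIntervalExchange.exists_sigma {ε l c : ℝ} (hε : 0 < ε) (hε' : ε < 1)
    (hl : max ε (1 - ε) < l) (hl' : l < 1) {I : ABC → Set ℝ}
    (hI : IsIntervalExchange (lo3 ε l c) (hi3 ε l c) (tr3 ε) I) :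
    ∃ J, IsIntervalExchange (lo2 ε c) (hi2 ε c) (tr2 ε) J ∧ ∀ a, I a ⊆ sigmaCylinder ε J a := by
  obtain ⟨h1, a1, b1, c1, dAB, dAC, dBC, a2, b2, c2, hAC, hAB, hBC, h8⟩ :=
    (isIntervalExchange_ABC_iff hl hl').1 hI
  obtain ⟨hl1, hl2⟩ := max_lt_iff.1 hl
  have hmem : ∀ x ∈ I .A ∪ I .B ∪ I .C,
      x ∈ (I .A ∪ I .B) ∪ (I .C ∪ {x | x - (1 - ε) ∈ I .B}) := by
    rintro x (h | h)
    exacts [Or.inl h, Or.inr (Or.inl h)]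
  refine ⟨![I .A ∪ I .B, I .C ∪ {x | x - (1 - ε) ∈ I .B}],
    (isIntervalExchange_fin_two_iff hε hε').2 ?_, ?_⟩
  · simp only [Matrix.cons_val_zero, Matrix.cons_val_one]
    refine ⟨?_, ?_, ?_, ?_, ?_, ?_, ?_, ?_⟩
    · intro x hx
      rcases lt_trichotomy x (c + l) with h | rfl | h
      · exact hmem x (h1 ⟨hx.1, h⟩)
      · have := h1 (⟨by linarith, by linarith⟩ : c + l - (1 - ε) ∈ Set.Ioo c (c + l))
        rcases this with (h | h) | h
        · have := a2 _ h
          rw [sub_add_cancel] at this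
          exact hmem _ this
        · exact Or.inr (Or.inr h)
        · linarith [(c1 h).1]
      · rcases h1 (⟨by linarith, by linarith [hx.2]⟩ : x - (1 - ε) ∈ Set.Ioo c (c + l))
          with (h' | h') | h'
        · linarith [(a1 h').2]
        · exact Or.inr (Or.inr h')
        · linarith [(c1 h').1, hx.2]
    · rintro x (h | h)
      · exact ⟨(a1 h).1, by linarith [(a1 h).2]⟩
      · exact ⟨by linarith [(b1 h).1], by linarith [(b1 h).2]⟩
    · rintro x (h | h)
      · exact ⟨(c1 h).1, by linarith [(c1 h).2]⟩
      · exact ⟨by linarith [(b1 h).1], by linarith [(b1 h).2]⟩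
    · rw [Set.disjoint_left]
      rintro x (h | h) (h' | h')
      · exact Set.disjoint_left.1 dAC h h'
      · linarith [(a1 h).2, (b1 h').1]
      · exact Set.disjoint_left.1 dBC h h'
      · linarith [(b1 h).2, (b1 h').1]
    · rintro x (h | h)
      · exact hmem _ (a2 x h)
      · exact Or.inr (Or.inr (by simpa using h))
    · rintro x (h | h)
      · exact hmem _ (c2 x h)
      · convert hmem _ (b2 _ h) using 1
        ring
    · rintro x (h | h) (h' | h')
      · exact hAC x h h'
      · have h' : x + 1 - (1 - ε) ∈ I .B := h'
        exact hAB x h (by convert h' using 1; ring)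
      · linarith [(b1 h).1, (c1 h').2]
      · have h' : x + 1 - (1 - ε) ∈ I .B := h'
        linarith [(b1 h).1, (b1 h').2]
    · rintro y (h | h | h)
      · rcases h8 y (Or.inl h) with h' | h' | h'
        · exact Or.inl (Or.inl h')
        · refine Or.inr (Or.inr (?_ : y + ε - (1 - ε) ∈ I .B))
          convert h' using 1; ring
        · exact Or.inr (Or.inl h')
      · rcases h8 y (Or.inr h) with h' | h' | h'
        · exact Or.inl (Or.inl h')
        · refine Or.inr (Or.inr (?_ : y + ε - (1 - ε) ∈ I .B))
          convert h' using 1; ring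
        · exact Or.inr (Or.inl h')
      · exact Or.inl (Or.inr h)
  · rintro (_ | _ | _) x hx
    · exact Or.inl hx
    · exact ⟨Or.inr hx, Or.inr (by simpa using hx)⟩
    · exact Or.inl hx

/-- Mirror image of the previous construction: `x ∈ I_B` now passes through `x - ε`, and these
points fill the gap from `c + l - 1` to `c`. -/
theorem IsIntervalExchange.exists_sigma' {ε l c : ℝ} (hε : 0 < ε) (hε' : ε < 1)
    (hl : max ε (1 - ε) < l) (hl' : l < 1) {I : ABC → Set ℝ}
    (hI : IsIntervalExchange (lo3 ε l c) (hi3 ε l c) (tr3 ε) I) :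
    ∃ J, IsIntervalExchange (lo2 ε (c + l - 1)) (hi2 ε (c + l - 1)) (tr2 ε) J ∧
      ∀ a, I a ⊆ sigmaCylinder' ε J a := by
  obtain ⟨h1, a1, b1, c1, dAB, dAC, dBC, a2, b2, c2, hAC, hAB, hBC, h8⟩ :=
    (isIntervalExchange_ABC_iff hl hl').1 hI
  obtain ⟨hl1, hl2⟩ := max_lt_iff.1 hl
  have hmem : ∀ x ∈ I .A ∪ I .B ∪ I .C,
      x ∈ (I .A ∪ {x | x + ε ∈ I .B}) ∪ (I .B ∪ I .C) := by
    rintro x ((h | h) | h)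
    exacts [Or.inl (Or.inl h), Or.inr (Or.inl h), Or.inr (Or.inr h)]
  refine ⟨![I .A ∪ {x | x + ε ∈ I .B}, I .B ∪ I .C],
    (isIntervalExchange_fin_two_iff hε hε').2 ?_, ?_⟩
  · simp only [Matrix.cons_val_zero, Matrix.cons_val_one]
    refine ⟨?_, ?_, ?_, ?_, ?_, ?_, ?_, ?_⟩
    · intro x hx
      have hx1 := hx.1
      have hx2 := hx.2
      rcases lt_trichotomy c x with h | rfl | h
      · exact hmem x (h1 ⟨h, by linarith⟩)
      · have := h1 (⟨by linarith, by linarith⟩ : c + ε ∈ Set.Ioo c (c + l))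
        rcases this with (h | h) | h
        · linarith [(a1 h).2]
        · exact Or.inl (Or.inr h)
        · have := c2 _ h
          rw [add_sub_cancel_right] at this
          exact hmem _ this
      · rcases h1 (⟨by linarith, by linarith⟩ : x + ε ∈ Set.Ioo c (c + l))
          with (h' | h') | h'
        · linarith [(a1 h').2]
        · exact Or.inl (Or.inr h')
        · linarith [(c1 h').1]
    · rintro x (h | h)
      · exact ⟨by linarith [(a1 h).1], by linarith [(a1 h).2]⟩
      · exact ⟨by linarith [(b1 h).1], by linarith [(b1 h).2]⟩
    · rintro x (h | h)
      · exact ⟨by linarith [(b1 h).1], by linarith [(b1 h).2]⟩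
      · exact ⟨by linarith [(c1 h).1], by linarith [(c1 h).2]⟩
    · rw [Set.disjoint_left]
      rintro x (h | h) (h' | h')
      · exact Set.disjoint_left.1 dAB h h'
      · exact Set.disjoint_left.1 dAC h h'
      · linarith [(b1 h).2, (b1 h').1]
      · linarith [(b1 h).2, (c1 h').1]
    · rintro x (h | h)
      · exact hmem _ (a2 x h)
      · convert hmem _ (b2 _ h) using 1
        ring
    · rintro x (h | h)
      · exact Or.inl (Or.inr (by simpa using h))
      · exact hmem _ (c2 x h)
    · rintro x (h | h) (h' | h')
      · linarith [(a1 h).1, (b1 h').2]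
      · exact hAC x h h'
      · have h : x + ε ∈ I .B := h
        linarith [(b1 h).1, (b1 h').2]
      · exact hBC _ h (by convert h' using 1; ring)
    · have key : ∀ y ∈ I .A ∪ I .B ∪ I .C, y - (1 - ε) ∈ I .A ∪ {x | x + ε ∈ I .B} ∨
          y + ε ∈ I .B ∪ I .C := by
        intro y hy
        rcases h8 y hy with h' | h' | h'
        · exact Or.inl (Or.inl h')
        · refine Or.inl (Or.inr (?_ : y - (1 - ε) + ε ∈ I .B))
          convert h' using 1; ring
        · exact Or.inr (Or.inr h')
      rintro y ((h | h) | h | h)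
      · exact key y (Or.inl (Or.inl h))
      · exact Or.inr (Or.inl h)
      · exact key y (Or.inl (Or.inr h))
      · exact key y (Or.inr h)
  · rintro (_ | _ | _) x hx
    · exact Or.inl hx
    · exact ⟨Or.inl hx, Or.inr (by simpa using hx)⟩
    · exact Or.inr hx

/-! ### From two intervals to three -/

/-- The partition common to two exchanges of two intervals. -/
def commonPartition (J J' : Fin 2 → Set ℝ) : ABC → Set ℝ
  | ABC.A => J 0 ∩ J' 0
  | ABC.B => J 0 ∩ J' 1
  | ABC.C => J 1 ∩ J' 1

/-- On the cells `A` and `C` both rotations act by the same translation, which is that of `T`. On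
`B` they act differently, but two steps of either give the translation of `T`, so the image stays in
both intervals. -/
theorem IsIntervalExchange.commonPartition {ε l c : ℝ} (hε : 0 < ε) (hε' : ε < 1)
    (hl : max ε (1 - ε) < l) (hl' : l < 1) {J J' : Fin 2 → Set ℝ}
    (hJ : IsIntervalExchange (lo2 ε c) (hi2 ε c) (tr2 ε) J)
    (hJ' : IsIntervalExchange (lo2 ε (c + l - 1)) (hi2 ε (c + l - 1)) (tr2 ε) J') :
    IsIntervalExchange (lo3 ε l c) (hi3 ε l c) (tr3 ε) (commonPartition J J') := by
  obtain ⟨h1, h2, h3, h4, h5, h6, h7, h8⟩ := (isIntervalExchange_fin_two_iff hε hε').1 hJ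
  obtain ⟨k1, k2, k3, k4, k5, k6, k7, k8⟩ := (isIntervalExchange_fin_two_iff hε hε').1 hJ'
  obtain ⟨hl1, hl2⟩ := max_lt_iff.1 hl
  rw [Set.disjoint_left] at h4 k4
  -- The fourth cell `J 1 ∩ J' 0` is empty, since `J' 0` ends at `c + l - 1 + ε`, to the left of `c
  -- + ε`.
  have hinter : ∀ x, x ∈ J 0 ∪ J 1 → x ∈ J' 0 ∪ J' 1 →
      x ∈ J 0 ∩ J' 0 ∪ J 0 ∩ J' 1 ∪ J 1 ∩ J' 1 := by
    rintro x (h | h) (h' | h')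
    · exact Or.inl (Or.inl ⟨h, h'⟩)
    · exact Or.inl (Or.inr ⟨h, h'⟩)
    · linarith [(h3 h).1, (k2 h').2]
    · exact Or.inr ⟨h, h'⟩
  rw [isIntervalExchange_ABC_iff hl hl']
  simp only [_root_.commonPartition]
  refine ⟨?_, ?_, ?_, ?_, ?_, ?_, ?_, ?_, ?_, ?_, ?_, ?_, ?_, ?_⟩
  · intro x hx
    exact hinter x (h1 ⟨hx.1, by linarith [hx.2]⟩)
      (k1 ⟨by linarith [hx.1], by linarith [hx.2]⟩)
  · rintro x ⟨h, h'⟩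
    exact ⟨(h2 h).1, by linarith [(k2 h').2]⟩
  · rintro x ⟨h, h'⟩
    exact ⟨by linarith [(k3 h').1], (h2 h).2⟩
  · rintro x ⟨h, h'⟩
    exact ⟨(h3 h).1, by linarith [(k3 h').2]⟩
  · rw [Set.disjoint_left]
    exact fun x hx hy => k4 hx.2 hy.2
  · rw [Set.disjoint_left]
    exact fun x hx hy => k4 hx.2 hy.2
  · rw [Set.disjoint_left]
    exact fun x hx hy => h4 hx.1 hy.1
  · rintro x ⟨h, h'⟩
    exact hinter _ (h5 x h) (k5 x h')
  · rintro x ⟨h, h'⟩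
    apply hinter
    · rcases h5 x h with g | g
      · linarith [(h2 g).2, (k3 h').1]
      · convert h6 _ g using 1
        ring
    · rcases k6 x h' with g | g
      · convert k5 _ g using 1
        ring
      · linarith [(k3 g).1, (h2 h).2]
  · rintro x ⟨h, h'⟩
    exact hinter _ (h6 x h) (k6 x h')
  · rintro x ⟨h, -⟩ ⟨g, -⟩
    exact h7 x h g
  · rintro x ⟨h, h'⟩ ⟨g, g'⟩
    rcases h5 _ g with e | e
    · linarith [(h2 e).2, (h2 h).1]
    · exact h7 x h (by convert e using 1; ring)
  · rintro x ⟨h, h'⟩ ⟨g, g'⟩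
    rcases k6 x h' with f | f
    · exact k7 _ f (by convert g' using 1; ring)
    · linarith [(k3 f).1, (h2 h).2]
  · intro y hy
    have hy1 : y ∈ J 0 ∪ J 1 := by
      rcases hy with (h | h) | h
      exacts [Or.inl h.1, Or.inl h.1, Or.inr h.1]
    have hy2 : y ∈ J' 0 ∪ J' 1 := by
      rcases hy with (h | h) | h
      exacts [Or.inl h.2, Or.inr h.2, Or.inr h.2]
    -- Backward steps in `J` and `J'` that agree give a preimage in `A` or `C`. If they disagree,
    -- only one combination is possible, and a second backward step in each leads to a common point
    -- of `B`.
    rcases h8 y hy1 with g | g <;> rcases k8 y hy2 with g' | g'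
    · exact Or.inl ⟨g, g'⟩
    · exfalso
      have := (h2 g).1
      have := (k3 g').2
      linarith
    · right; left
      constructor
      · rcases h8 _ (Or.inr g) with f | f
        · convert f using 1
          ring
        · linarith [(h3 f).2, (k2 g').1]
      · rcases k8 _ (Or.inl g') with f | f
        · linarith [(k2 f).1, (h3 g).2]
        · convert f using 1
          ring
    · exact Or.inr (Or.inr ⟨g, g'⟩)

/-! ### Codings with irrational parameter -/

theorem abs_le_of_mem_Icc_add_one {c x : ℝ} (hx : x ∈ Set.Icc c (c + 1)) : |x| ≤ |c| + 1 := by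
  rw [abs_le]
  constructor
  · linarith [neg_abs_le c, hx.1]
  · linarith [le_abs_self c, hx.2]

theorem tr2_eq (ε : ℝ) (a : Fin 2) :
    tr2 ε a = ((![1, 0] : Fin 2 → ℤ) a : ℝ) - ((fun _ => 1 : Fin 2 → ℤ) a : ℝ) * ε := by
  fin_cases a <;> simp [tr2]

/-- The number of letters of `σ(a)`. -/
def sigmaLength : ABC → ℤ
  | ABC.A => 1
  | ABC.B => 2
  | ABC.C => 1

/-- The number of letters `0` of `σ(a)`. -/
def sigmaCountZero : ABC → ℤ
  | ABC.A => 1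
  | ABC.B => 1
  | ABC.C => 0

theorem one_le_sigmaLength (a : ABC) : 1 ≤ sigmaLength a := by
  cases a <;> simp [sigmaLength]

theorem tr3_eq (ε : ℝ) (a : ABC) : tr3 ε a = sigmaCountZero a - sigmaLength a * ε := by
  cases a <;> simp [tr3, sigmaCountZero, sigmaLength]

theorem isAperiodicWord_iff_irrational_two {ε c : ℝ} {J : Fin 2 → Set ℝ}
    (hd : Pairwise (fun a b => Disjoint (J a) (J b))) (hJ : ∀ a, J a ⊆ Set.Icc c (c + 1))
    {v : ℕ → Fin 2} (hv : CodesOrbit J (tr2 ε) v) : IsAperiodicWord v ↔ Irrational ε := by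
  rw [codesOrbit_iff hd] at hv
  have hM : ∀ n, |orbitPos (tr2 ε) v n| ≤ |c| + 1 := fun n =>
    abs_le_of_mem_Icc_add_one (hJ _ (hv n))
  exact ⟨irrational_of_isAperiodicWord (tr2_eq ε) hd hv hM,
    fun h => isAperiodicWord_of_irrational (tr2_eq ε) (by simp) h hM⟩

theorem isAperiodicWord_iff_irrational_three {ε c : ℝ} {I : ABC → Set ℝ}
    (hd : Pairwise (fun a b => Disjoint (I a) (I b))) (hI : ∀ a, I a ⊆ Set.Icc c (c + 1))
    {u : ℕ → ABC} (hu : CodesOrbit I (tr3 ε) u) : IsAperiodicWord u ↔ Irrational ε := by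
  rw [codesOrbit_iff hd] at hu
  have hM : ∀ n, |orbitPos (tr3 ε) u n| ≤ |c| + 1 := fun n =>
    abs_le_of_mem_Icc_add_one (hI _ (hu n))
  exact ⟨irrational_of_isAperiodicWord (tr3_eq ε) hd hu hM,
    fun h => isAperiodicWord_of_irrational (tr3_eq ε) one_le_sigmaLength h hM⟩

/-- The integer parts cancel in the difference of the two positions, leaving `ε' - ε` times a
coefficient that is at least `n` up to sign; this stays bounded only if the parameters agree. -/
theorem eq_of_orbitPos_tr3_bounded {ε ε' M M' : ℝ} {u : ℕ → ABC}
    (h : ∀ n, |orbitPos (tr3 ε) u n| ≤ M) (h' : ∀ n, |orbitPos (tr3 ε') u n| ≤ M') : ε = ε' := by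
  rw [← sub_eq_zero]
  apply eq_zero_of_nat_mul_bounded (M := M + M')
  intro n
  have hn : (n : ℝ) ≤ (∑ i ∈ Finset.range n, sigmaLength (u i) : ℤ) := by
    have : (n : ℤ) ≤ ∑ i ∈ Finset.range n, sigmaLength (u i) := by
      have := Finset.card_nsmul_le_sum (Finset.range n) (fun i => sigmaLength (u i)) 1
        (fun i _ => one_le_sigmaLength _)
      simpa using this
    exact_mod_cast this
  have e := orbitPos_eq_sub (tr3_eq ε) u n
  have e' := orbitPos_eq_sub (tr3_eq ε') u n
  generalize ((∑ i ∈ Finset.range n, sigmaLength (u i) : ℤ) : ℝ) = q at *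
  calc |(n : ℝ) * (ε - ε')| = n * |ε - ε'| := by rw [abs_mul, Nat.abs_cast]
    _ ≤ q * |ε - ε'| := by gcongr
    _ = |q * (ε - ε')| := by rw [abs_mul, abs_of_nonneg ((Nat.cast_nonneg n).trans hn)]
    _ = |orbitPos (tr3 ε') u n - orbitPos (tr3 ε) u n| := by rw [e, e']; ring_nf
    _ ≤ |orbitPos (tr3 ε') u n| + |orbitPos (tr3 ε) u n| := abs_sub _ _
    _ ≤ M + M' := by linarith [h n, h' n]

theorem lt_of_infinite_of_mem_Icc {f : ℕ → ℝ} (hf : Function.Injective f) {S : Set ℕ}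
    (hS : S.Infinite) {a b : ℝ} (h : ∀ n ∈ S, f n ∈ Set.Icc a b) : a < b := by
  obtain ⟨m, hm, n, hn, hmn⟩ := hS.nontrivial
  by_contra hab
  apply hmn
  apply hf
  have h1 := h m hm
  have h2 := h n hn
  linarith [h1.1, h1.2, h2.1, h2.2]

/-- Each cell contains infinitely many distinct orbit points, so the closed interval around it is
nondegenerate. For `A`, `B`, `C` this says `α, β, γ > 0` with `l = 1 + c' - c`. -/
theorem lengths_of_codings {ε c c' : ℝ} {J J' : Fin 2 → Set ℝ} {u : ℕ → ABC}
    (hJ : ∀ a, J a ⊆ Set.Icc (lo2 ε c a) (hi2 ε c a))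
    (hJ' : ∀ a, J' a ⊆ Set.Icc (lo2 ε c' a) (hi2 ε c' a))
    (hε : Irrational ε) (hinf : ∀ a, {n | u n = a}.Infinite)
    (hu : ∀ n, orbitPos (tr3 ε) u n ∈ commonPartition J J' (u n)) :
    max ε (1 - ε) < 1 + c' - c ∧ 1 + c' - c < 1 := by
  have hinj := orbitPos_injective (tr3_eq ε) one_le_sigmaLength hε u
  have hmem : ∀ a, ∀ n ∈ {n | u n = a}, orbitPos (tr3 ε) u n ∈ commonPartition J J' a := by
    rintro a n rfl
    exact hu n
  have j0 : J 0 ⊆ Set.Icc c (c + ε) := hJ 0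
  have j1 : J 1 ⊆ Set.Icc (c + ε) (c + 1) := hJ 1
  have j0' : J' 0 ⊆ Set.Icc c' (c' + ε) := hJ' 0
  have j1' : J' 1 ⊆ Set.Icc (c' + ε) (c' + 1) := hJ' 1
  have hA : c < c' + ε := lt_of_infinite_of_mem_Icc hinj (hinf .A) fun n hn =>
    ⟨(j0 (hmem .A n hn).1).1, (j0' (hmem .A n hn).2).2⟩
  have hB : c' + ε < c + ε := lt_of_infinite_of_mem_Icc hinj (hinf .B) fun n hn =>
    ⟨(j1' (hmem .B n hn).2).1, (j0 (hmem .B n hn).1).2⟩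
  have hC : c + ε < c' + 1 := lt_of_infinite_of_mem_Icc hinj (hinf .C) fun n hn =>
    ⟨(j1 (hmem .C n hn).1).1, (j1' (hmem .C n hn).2).2⟩
  refine ⟨max_lt ?_ ?_, ?_⟩ <;> linarith

theorem subset_Icc_of_subset_two {ε c : ℝ} (hε : 0 < ε) (hε' : ε < 1) {J : Fin 2 → Set ℝ}
    (hJ : ∀ a, J a ⊆ Set.Icc (lo2 ε c a) (hi2 ε c a)) (a : Fin 2) :
    J a ⊆ Set.Icc c (c + 1) := by
  refine (hJ a).trans ?_
  fin_cases a <;> refine Set.Icc_subset_Icc ?_ ?_ <;> simp [lo2, hi2] <;> linarith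

theorem subset_Icc_of_subset_three {ε l c : ℝ} (hl : max ε (1 - ε) < l) (hl' : l < 1)
    {I : ABC → Set ℝ} (hI : ∀ a, I a ⊆ Set.Icc (lo3 ε l c a) (hi3 ε l c a)) (a : ABC) :
    I a ⊆ Set.Icc c (c + 1) := by
  obtain ⟨hl1, hl2⟩ := max_lt_iff.1 hl
  refine (hI a).trans ?_
  cases a <;> refine Set.Icc_subset_Icc ?_ ?_ <;> simp only [lo3, hi3] <;> linarith

theorem sigmaCylinder_subset {ε c : ℝ} {J : Fin 2 → Set ℝ} (hJ : ∀ a, J a ⊆ Set.Icc c (c + 1))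
    (a : ABC) : sigmaCylinder ε J a ⊆ Set.Icc c (c + 1) := by
  cases a
  exacts [hJ 0, fun x hx => hJ 0 hx.1, hJ 1]

theorem sigmaCylinder'_subset {ε c : ℝ} {J : Fin 2 → Set ℝ} (hJ : ∀ a, J a ⊆ Set.Icc c (c + 1))
    (a : ABC) : sigmaCylinder' ε J a ⊆ Set.Icc c (c + 1) := by
  cases a
  exacts [hJ 0, fun x hx => hJ 1 hx.1, hJ 1]

theorem mem_commonPartition {ε : ℝ} {J J' : Fin 2 → Set ℝ} {a : ABC} {x : ℝ}
    (h : x ∈ sigmaCylinder ε J a) (h' : x ∈ sigmaCylinder' ε J' a) :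
    x ∈ commonPartition J J' a := by
  cases a
  exacts [⟨h, h'⟩, ⟨h.1, h'.1⟩, ⟨h, h'⟩]

/-- If `J`, `J'` code `σ(u)`, `σ'(u)`, their parameters agree, and their common partition consists
of three nondegenerate intervals and contains the orbit coded by `u`. -/
theorem common_of_codings {ε ε' c c' : ℝ} (hε : 0 < ε) (hε1 : ε < 1) (hε' : 0 < ε') (hε1' : ε' < 1)
    {J J' : Fin 2 → Set ℝ} {u : ℕ → ABC}
    (hd : Pairwise (fun a b => Disjoint (J a) (J b)))
    (hd' : Pairwise (fun a b => Disjoint (J' a) (J' b)))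
    (hJ : ∀ a, J a ⊆ Set.Icc (lo2 ε c a) (hi2 ε c a))
    (hJ' : ∀ a, J' a ⊆ Set.Icc (lo2 ε' c' a) (hi2 ε' c' a))
    (hap : IsAperiodicWord (imageWord sigmaMor sigmaMor_ne_nil u))
    (hinf : ∀ a, {n | u n = a}.Infinite)
    (hu : CodesOrbit J (tr2 ε) (imageWord sigmaMor sigmaMor_ne_nil u))
    (hu' : CodesOrbit J' (tr2 ε') (imageWord sigmaMor' sigmaMor'_ne_nil u)) :
    ε = ε' ∧ Irrational ε ∧ max ε (1 - ε) < 1 + c' - c ∧ 1 + c' - c < 1 ∧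
      ∀ n, orbitPos (tr3 ε) u n ∈ commonPartition J J' (u n) := by
  have hb := subset_Icc_of_subset_two hε hε1 hJ
  have hb' := subset_Icc_of_subset_two hε' hε1' hJ'
  have hirr := (isAperiodicWord_iff_irrational_two hd hb hu).1 hap
  rw [codesOrbit_sigma_iff hd] at hu
  rw [codesOrbit_sigma'_iff hd'] at hu'
  obtain rfl : ε = ε' := eq_of_orbitPos_tr3_bounded
    (fun n => abs_le_of_mem_Icc_add_one (sigmaCylinder_subset hb _ (hu n)))
    (fun n => abs_le_of_mem_Icc_add_one (sigmaCylinder'_subset hb' _ (hu' n)))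
  have hmem : ∀ n, orbitPos (tr3 ε) u n ∈ commonPartition J J' (u n) := fun n =>
    mem_commonPartition (hu n) (hu' n)
  obtain ⟨h1, h2⟩ := lengths_of_codings hJ hJ' hirr hinf hmem
  exact ⟨rfl, hirr, h1, h2, hmem⟩

/-! ### Left-closed right-open intervals -/

theorem disjoint_Ico_two (ε c : ℝ) :
    Pairwise (fun a b => Disjoint (Set.Ico (lo2 ε c a) (hi2 ε c a))
      (Set.Ico (lo2 ε c b) (hi2 ε c b))) := by
  apply pairwise_disjoint_fin_two (J := fun a => Set.Ico (lo2 ε c a) (hi2 ε c a))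
  rw [Set.disjoint_left]
  intro x hx hy
  exact absurd hx.2 (not_lt.2 hy.1)

theorem disjoint_Ico_three {ε l : ℝ} (hl' : l < 1) (c : ℝ) :
    Pairwise (fun a b => Disjoint (Set.Ico (lo3 ε l c a) (hi3 ε l c a))
      (Set.Ico (lo3 ε l c b) (hi3 ε l c b))) := by
  apply pairwise_disjoint_ABC (I := fun a => Set.Ico (lo3 ε l c a) (hi3 ε l c a)) <;>
  · rw [Set.disjoint_left]
    rintro x ⟨h1, h2⟩ ⟨h3, h4⟩
    simp only [lo3, hi3] at h1 h2 h3 h4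
    linarith

/-- In the left-closed setting only the coding has to be transferred, so an inclusion of cells
replaces the construction of an exchange. -/
theorem Ico_three_subset_sigmaCylinder {ε l : ℝ} (hl : max ε (1 - ε) < l) (hl' : l < 1) (c : ℝ)
    (a : ABC) : Set.Ico (lo3 ε l c a) (hi3 ε l c a) ⊆
      sigmaCylinder ε (fun a => Set.Ico (lo2 ε c a) (hi2 ε c a)) a := by
  obtain ⟨hl1, hl2⟩ := max_lt_iff.1 hl
  rintro x ⟨h1, h2⟩
  cases a <;> simp [lo3, hi3, lo2, hi2, sigmaCylinder] at h1 h2 ⊢ <;> refine ⟨?_, ?_⟩ <;>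
    (try refine ⟨?_, ?_⟩) <;> linarith

theorem Ico_three_subset_sigmaCylinder' {ε l : ℝ} (hl : max ε (1 - ε) < l) (hl' : l < 1) (c : ℝ)
    (a : ABC) : Set.Ico (lo3 ε l c a) (hi3 ε l c a) ⊆
      sigmaCylinder' ε (fun a => Set.Ico (lo2 ε (c + l - 1) a) (hi2 ε (c + l - 1) a)) a := by
  obtain ⟨hl1, hl2⟩ := max_lt_iff.1 hl
  rintro x ⟨h1, h2⟩
  cases a <;> simp [lo3, hi3, lo2, hi2, sigmaCylinder'] at h1 h2 ⊢ <;> refine ⟨?_, ?_⟩ <;>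
    (try refine ⟨?_, ?_⟩) <;> linarith

theorem commonPartition_Ico_subset (ε c c' : ℝ) (a : ABC) :
    commonPartition (fun a => Set.Ico (lo2 ε c a) (hi2 ε c a))
      (fun a => Set.Ico (lo2 ε c' a) (hi2 ε c' a)) a ⊆
      Set.Ico (lo3 ε (1 + c' - c) c a) (hi3 ε (1 + c' - c) c a) := by
  rintro x hx
  cases a <;> obtain ⟨⟨h1, h2⟩, h3, h4⟩ := hx <;> simp [lo3, hi3, lo2, hi2] at h1 h2 h3 h4 ⊢ <;>
    refine ⟨?_, ?_⟩ <;> linarith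

/-! ### The two equivalences -/

theorem theoremA (u : ℕ → ABC) (hu : ∀ a : ABC, ∃ ρ : ℝ, 0 < ρ ∧ HasLetterDensity u a ρ) :
    ((IsAperiodicWord u ∧ Is3iet u) ↔
      (IsSturmian (imageWord sigmaMor sigmaMor_ne_nil u) ∧
        IsSturmian (imageWord sigmaMor' sigmaMor'_ne_nil u))) ∧
    ((IsAperiodicWord u ∧ IsLeftClosed3iet u) ↔
      (IsLeftClosedSturmian (imageWord sigmaMor sigmaMor_ne_nil u) ∧
        IsLeftClosedSturmian (imageWord sigmaMor' sigmaMor'_ne_nil u))) := by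
  have hinf : ∀ a, {n | u n = a}.Infinite := fun a => by
    obtain ⟨ρ, hρ, h⟩ := hu a
    exact h.infinite hρ
  refine ⟨⟨?_, ?_⟩, ⟨?_, ?_⟩⟩
  · rintro ⟨hap, ε, l, c, hε, hε', hl, hl', I, hI, hc⟩
    have hirr := (isAperiodicWord_iff_irrational_three hI.disjoint
      (subset_Icc_of_subset_three hl hl' hI.subset_Icc) hc).1 hap
    rw [codesOrbit_iff hI.disjoint] at hc
    obtain ⟨J, hJ, hsub⟩ := hI.exists_sigma hε hε' hl hl'
    obtain ⟨J', hJ', hsub'⟩ := hI.exists_sigma' hε hε' hl hl'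
    have hv := (codesOrbit_sigma_iff hJ.disjoint u).2 fun n => hsub _ (hc n)
    have hv' := (codesOrbit_sigma'_iff hJ'.disjoint u).2 fun n => hsub' _ (hc n)
    exact ⟨⟨(isAperiodicWord_iff_irrational_two hJ.disjoint
        (subset_Icc_of_subset_two hε hε' hJ.subset_Icc) hv).2 hirr, ε, c, hε, hε', J, hJ, hv⟩,
      (isAperiodicWord_iff_irrational_two hJ'.disjoint
        (subset_Icc_of_subset_two hε hε' hJ'.subset_Icc) hv').2 hirr, ε, c + l - 1, hε, hε', J',
        hJ', hv'⟩
  · rintro ⟨⟨hap, ε, c, hε, hε1, J, hJ, hv⟩, -, ε', c', hε', hε1', J', hJ', hv'⟩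
    obtain ⟨rfl, hirr, hl, hl', hmem⟩ := common_of_codings hε hε1 hε' hε1' hJ.disjoint
      hJ'.disjoint hJ.subset_Icc hJ'.subset_Icc hap hinf hv hv'
    -- The length `l = 1 + c' - c` is the one for which the second exchange starts at `c + l - 1 =
    -- c'`.
    have hI := IsIntervalExchange.commonPartition hε hε1 hl hl' hJ
      (J' := J') (by rwa [show c + (1 + c' - c) - 1 = c' by ring])
    have hc := (codesOrbit_iff hI.disjoint).2 hmem
    exact ⟨(isAperiodicWord_iff_irrational_three hI.disjoint
      (subset_Icc_of_subset_three hl hl' hI.subset_Icc) hc).2 hirr,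
      ε, 1 + c' - c, c, hε, hε1, hl, hl', _, hI, hc⟩
  · rintro ⟨hap, ε, l, c, hε, hε', hl, hl', -, -, hc⟩
    have hirr := (isAperiodicWord_iff_irrational_three (disjoint_Ico_three hl' c)
      (subset_Icc_of_subset_three hl hl' fun _ => Set.Ico_subset_Icc_self) hc).1 hap
    rw [codesOrbit_iff (disjoint_Ico_three hl' c)] at hc
    have hv := (codesOrbit_sigma_iff (disjoint_Ico_two ε c) u).2 fun n =>
      Ico_three_subset_sigmaCylinder hl hl' c _ (hc n)
    have hv' := (codesOrbit_sigma'_iff (disjoint_Ico_two ε (c + l - 1)) u).2 fun n =>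
      Ico_three_subset_sigmaCylinder' hl hl' c _ (hc n)
    exact ⟨⟨(isAperiodicWord_iff_irrational_two (disjoint_Ico_two ε c)
        (subset_Icc_of_subset_two hε hε' fun _ => Set.Ico_subset_Icc_self) hv).2 hirr,
        ε, c, hε, hε', hv⟩,
      (isAperiodicWord_iff_irrational_two (disjoint_Ico_two ε (c + l - 1))
        (subset_Icc_of_subset_two hε hε' fun _ => Set.Ico_subset_Icc_self) hv').2 hirr,
        ε, c + l - 1, hε, hε', hv'⟩
  · rintro ⟨⟨hap, ε, c, hε, hε1, hv⟩, -, ε', c', hε', hε1', hv'⟩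
    obtain ⟨rfl, hirr, hl, hl', hmem⟩ := common_of_codings hε hε1 hε' hε1'
      (disjoint_Ico_two ε c) (disjoint_Ico_two ε' c') (fun _ => Set.Ico_subset_Icc_self)
      (fun _ => Set.Ico_subset_Icc_self) hap hinf hv hv'
    have hd := disjoint_Ico_three (ε := ε) hl' c
    have hmem' := fun n => commonPartition_Ico_subset ε c c' _ (hmem n)
    have hc := (codesOrbit_iff hd).2 hmem'
    -- The orbit starts at `0`, which therefore lies in the cell of `u 0`; this gives the bounds on
    -- `c`.
    have h0 : 0 ∈ Set.Ico c (c + (1 + c' - c)) := by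
      obtain ⟨hl1, hl2⟩ := max_lt_iff.1 hl
      obtain ⟨h1, h2⟩ := hmem' 0
      rw [orbitPos_zero] at h1 h2
      generalize u 0 = a at h1 h2
      cases a <;> simp only [lo3, hi3] at h1 h2 <;> constructor <;> linarith
    exact ⟨(isAperiodicWord_iff_irrational_three hd
      (subset_Icc_of_subset_three hl hl' fun _ => Set.Ico_subset_Icc_self) hc).2 hirr,
      ε, 1 + c' - c, c, hε, hε1, hl, hl', by linarith [h0.2], h0.1, hc⟩
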